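/- Let $(S,d)$ be a complete separable metric space with its Borel $\sigma$-algebra, and let $(\Omega,\mathcal F,P)$ be a complete nonatomic probability space (nonatomic: every $A\in\mathcal F$ with $P(A)>0$ has a subset $B\in\mathcal F$ with $0<P(B)<P(A)$). For $S$-valued random variables $X,Y$ on $\Omega$ let $$\rho(X,Y)=\inf\{\varepsilon>0:\ P\{\omega:\ d(X(\omega),Y(\omega))\ge\varepsilon\}\le\varepsilon\}$$ be the Ky Fan distance, and for Borel probability measures $\mu,\nu$ on $S$ let $$q(\mu,\nu)=\inf\{\varepsilon>0:\ \mu(A)\le\nu(A^{\varepsilon})+\varepsilon\ \text{ for all closed } A\subset S\},\qquad A^{\varepsilon}=\{x\in S:\ d(x,a)<\varepsilon\text{ for some }a\in A\},$$ be the Prokhorov distance. Let $\mathrm{law}(X)=P\circ X^{-1}$ denote the distribution of $X$. Let $X,Y:\Omega\to S$ be random variables and let $\varepsilon>0$ be such that $q(\mathrm{law}(X),\mathrm{law}(Y))<\varepsilon$. Then there is a random variable $Y':\Omega\to S$, on the same probability space, such that $\mathrm{law}(Y')=\mathrm{law}(Y)$ and $\rho(X,Y')<\varepsilon$. -/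

import Mathlib

open MeasureTheory

/-- A measure is nonatomic if it has no atoms in the measure-theoretic sense: every measurable set
of positive measure has a measurable subset of strictly smaller positive measure. (This is not
the condition that singletons are null.) -/
def IsNonatomic {Ω : Type*} [MeasurableSpace Ω] (P : Measure Ω) : Prop :=
  ∀ A : Set Ω, MeasurableSet A → 0 < P A →
    ∃ B : Set Ω, B ⊆ A ∧ MeasurableSet B ∧ 0 < P B ∧ P B < P A

/-- The Ky Fan distance of two random variables with values in a metric space,
`ρ(X, Y) = inf {ε > 0 : P{d(X, Y) ≥ ε} ≤ ε}`. -/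
noncomputable def kyFanDist {Ω S : Type*} [MeasurableSpace Ω] [MetricSpace S]
    (P : Measure Ω) (X Y : Ω → S) : ℝ :=
  sInf {ε : ℝ | 0 < ε ∧ P {ω | ε ≤ dist (X ω) (Y ω)} ≤ ENNReal.ofReal ε}

/-- The Prokhorov distance of two (probability) measures on a metric space,
`q(μ, ν) = inf {ε > 0 : μ(A) ≤ ν(A^ε) + ε for all closed A}`, where
`A^ε = {x : d(x, a) < ε for some a ∈ A}` is the open `ε`-neighbourhood of `A`. -/
noncomputable def prokhorovDist {S : Type*} [MetricSpace S] [MeasurableSpace S]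
    (μ ν : Measure S) : ℝ :=
  sInf {ε : ℝ | 0 < ε ∧
    ∀ A : Set S, IsClosed A → μ A ≤ ν (Metric.thickening ε A) + ENNReal.ofReal ε}

open ProbabilityTheory Filter Topology unitInterval

/-! Cut `S` into finitely many cells: small ones, and a remainder negligible for both laws. The
Prokhorov inequality becomes a Hall condition with deficiency between the cell masses, so a matrix
with these marginals puts little mass on pairs of cells that are not `δ`-close
(`exists_finite_coupling`). Only cell indices are coupled. On the event that `X` lies in cell `i`,
nonatomicity allows any law of the right mass to be realized
(`IsNonatomic.exists_measurable_map_eq`); a mixture of restrictions of `law(Y)` to the cells is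
chosen, with weights read off the matrix. Gluing over `i` gives exactly `law(Y)`
(`exists_rearrangement`), and `X`, `Y'` are close whenever their cells are. -/

/-! ### Atomless laws on the line -/

/-- The distribution function of an atomless law on the line is continuous. -/
theorem continuous_cdf_of_nullSingleton (ν : Measure ℝ) [IsProbabilityMeasure ν]
    [NullSingletonClass ν] : Continuous (cdf ν) := by
  rw [continuous_iff_continuousAt]
  intro x
  rw [(monotone_cdf ν).continuousAt_iff_leftLim_eq_rightLim, StieltjesFunction.rightLim_eq]
  have h : (cdf ν).measure {x} = 0 := by rw [measure_cdf]; exact measure_singleton x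
  rw [StieltjesFunction.measure_singleton, ENNReal.ofReal_eq_zero] at h
  exact le_antisymm ((monotone_cdf ν).leftLim_le le_rfl) (by linarith)

theorem exists_cdf_eq (ν : Measure ℝ) [IsProbabilityMeasure ν] [NullSingletonClass ν]
    {s : ℝ} (h0 : 0 < s) (h1 : s < 1) : ∃ x, cdf ν x = s :=
  mem_range_of_exists_le_of_exists_ge (continuous_cdf_of_nullSingleton ν)
    (((tendsto_cdf_atBot ν).eventually_le_const h0).exists)
    (((tendsto_cdf_atTop ν).eventually_const_le h1).exists)

theorem measureReal_cdf_le (ν : Measure ℝ) [IsProbabilityMeasure ν] [NullSingletonClass ν]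
    {t : ℝ} (h0 : 0 ≤ t) (h1 : t ≤ 1) : ν.real {x | cdf ν x ≤ t} = t := by
  apply le_antisymm
  · by_contra! h
    obtain ⟨s, hts, hs⟩ := exists_between h
    obtain ⟨y, hy⟩ := exists_cdf_eq ν (h0.trans_lt hts) (hs.trans_le measureReal_le_one)
    have : ν.real {x | cdf ν x ≤ t} ≤ ν.real (Set.Iic y) := by
      refine measureReal_mono fun x hx => ?_
      by_contra hxy
      have := monotone_cdf ν (le_of_not_ge hxy)
      have hx' : cdf ν x ≤ t := hx
      linarith
    rw [← ProbabilityTheory.cdf_eq_real, hy] at this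
    linarith
  -- The cdf need not attain 0 or 1, so the endpoints are treated apart.
  · rcases h0.eq_or_lt with rfl | h0
    · exact measureReal_nonneg
    rcases h1.eq_or_lt with rfl | h1
    · simp [cdf_le_one]
    obtain ⟨y, hy⟩ := exists_cdf_eq ν h0 h1
    calc t = ν.real (Set.Iic y) := by rw [← ProbabilityTheory.cdf_eq_real, hy]
      _ ≤ _ := measureReal_mono fun x hx => hy ▸ monotone_cdf ν hx

/-- Probability integral transform. -/
theorem exists_map_eq_volume_unitInterval (ν : Measure ℝ) [IsProbabilityMeasure ν]
    [NullSingletonClass ν] : ∃ F : ℝ → I, Measurable F ∧ ν.map F = volume := by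
  let F : ℝ → I := fun x => ⟨cdf ν x, cdf_nonneg ν x, cdf_le_one ν x⟩
  have hF : Measurable F := (monotone_cdf ν).measurable.subtype_mk
  have := Measure.isProbabilityMeasure_map (μ := ν) hF.aemeasurable
  refine ⟨F, hF, Measure.ext_of_Iic _ _ fun t => ?_⟩
  rw [Measure.map_apply hF measurableSet_Iic, unitInterval.volume_Iic,
    ← measureReal_cdf_le ν t.2.1 t.2.2, ofReal_measureReal]
  rfl

/-! ### Realizing laws on nonatomic spaces -/

section Nonatomic

variable {Ω : Type*} [MeasurableSpace Ω]

/-- The binary tree of sets generated by repeatedly splitting off `B`. -/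
def splitTree (B : Set Ω → Set Ω) : List Bool → Set Ω
  | [] => Set.univ
  | true :: l => B (splitTree B l)
  | false :: l => splitTree B l \ B (splitTree B l)

/-- A measurable set can be split in a way that is optimal up to a factor `2`. -/
theorem exists_balanced_split (μ : Measure Ω) [IsFiniteMeasure μ] (A : Set Ω) :
    ∃ B : Set Ω, B ⊆ A ∧ MeasurableSet B ∧ ∀ C ⊆ A, MeasurableSet C →
      min (μ.real C) (μ.real (A \ C)) ≤ 2 * min (μ.real B) (μ.real (A \ B)) := by
  let K : Set ℝ := {x | ∃ C ⊆ A, MeasurableSet C ∧ min (μ.real C) (μ.real (A \ C)) = x}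
  have hK : BddAbove K := by
    refine ⟨μ.real Set.univ, ?_⟩
    rintro _ ⟨C, -, -, rfl⟩
    exact (min_le_left _ _).trans (measureReal_mono (Set.subset_univ _))
  by_cases h : 0 < sSup K
  · obtain ⟨_, ⟨B, hBA, hB, rfl⟩, hlt⟩ := exists_lt_of_lt_csSup
      (⟨_, ∅, Set.empty_subset _, MeasurableSet.empty, rfl⟩ : K.Nonempty) (half_lt_self h)
    refine ⟨B, hBA, hB, fun C hCA hC => ?_⟩
    have := le_csSup hK ⟨C, hCA, hC, rfl⟩
    linarith
  · refine ⟨∅, Set.empty_subset _, MeasurableSet.empty, fun C hCA hC => ?_⟩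
    have := le_csSup hK ⟨C, hCA, hC, rfl⟩
    have h2 : 0 ≤ min (μ.real (∅ : Set Ω)) (μ.real (A \ ∅)) := by positivity
    linarith

/-- A nonatomic finite measure has a real random variable whose law has no point masses. -/
theorem exists_nullSingleton_map (μ : Measure Ω) [IsFiniteMeasure μ] (hμ : IsNonatomic μ) :
    ∃ g : Ω → ℝ, Measurable g ∧ NullSingletonClass (μ.map g) := by
  choose B hBA hB hopt using exists_balanced_split μ
  have hT : ∀ l, MeasurableSet (splitTree B l) := by
    intro l
    induction l with
    | nil => exact MeasurableSet.univ
    | cons b l ih =>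
      cases b
      · exact ih.diff (hB _)
      · exact hB _
  -- `G` records the side of every split, so each fibre stays inside one branch of the tree.
  let G : Ω → (List Bool → Prop) := fun ω l => ω ∈ B (splitTree B l)
  have hG : Measurable G := measurable_pi_iff.2 fun l => (hB _).mem
  have hfib : ∀ x, μ (G ⁻¹' {x}) = 0 := by
    intro x
    by_contra hne
    let F := G ⁻¹' {x}
    have hF : MeasurableSet F := hG (measurableSet_singleton x)
    obtain ⟨C, hCF, hC, hC0, hClt⟩ := hμ F hF (pos_iff_ne_zero.2 hne)
    have hFC : 0 < μ.real (F \ C) := by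
      rw [measureReal_sdiff hCF hC]
      have : μ.real C < μ.real F := (ENNReal.toReal_lt_toReal (by finiteness) (by finiteness)).2 hClt
      linarith
    have hC0' : 0 < μ.real C := ENNReal.toReal_pos hC0.ne' (by finiteness)
    obtain ⟨δ, hδ, hδC, hδF⟩ : ∃ δ > 0, δ ≤ μ.real C ∧ δ ≤ μ.real (F \ C) :=
      ⟨_, lt_min hC0' hFC, min_le_left _ _, min_le_right _ _⟩
    -- `C` competes in the split of every node containing `F`, so near-optimality makes both halves
    -- weigh at least `δ / 2`. Each step down the branch loses that much, which finite mass forbids.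
    have key : ∀ n : ℕ, ∃ l, F ⊆ splitTree B l ∧
        μ.real (splitTree B l) + n * (δ / 2) ≤ μ.real Set.univ := by
      intro n
      induction n with
      | zero => exact ⟨[], Set.subset_univ _, by simp [splitTree]⟩
      | succ n ih =>
        obtain ⟨l, hl, hm⟩ := ih
        have h1 := hopt (splitTree B l) C (hCF.trans hl) hC
        have h2 : δ ≤ min (μ.real C) (μ.real (splitTree B l \ C)) :=
          le_min hδC (hδF.trans (measureReal_mono (Set.sdiff_subset_sdiff_left hl)))
        have h3 := min_le_left (μ.real (B (splitTree B l)))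
          (μ.real (splitTree B l \ B (splitTree B l)))
        have h4 := min_le_right (μ.real (B (splitTree B l)))
          (μ.real (splitTree B l \ B (splitTree B l)))
        have h5 := measureReal_sdiff (μ := μ) (hBA (splitTree B l)) (hB _)
        by_cases hx : x l
        · refine ⟨true :: l, fun ω hω => ?_, ?_⟩
          · have : G ω l = x l := congrFun hω l
            exact this.mpr hx
          · push_cast
            simp only [splitTree]
            linarith
        · refine ⟨false :: l, fun ω hω => ⟨hl hω, fun h => ?_⟩, ?_⟩
          · have : G ω l = x l := congrFun hω l
            exact hx (this.mp h)
          · push_cast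
            simp only [splitTree]
            linarith
    obtain ⟨n, hn⟩ := exists_nat_gt (μ.real Set.univ / (δ / 2))
    obtain ⟨l, -, hl⟩ := key n
    rw [div_lt_iff₀ (by positivity)] at hn
    have : 0 ≤ μ.real (splitTree B l) := measureReal_nonneg
    linarith
  have he := measurableEmbedding_embeddingReal (List Bool → Prop)
  refine ⟨embeddingReal _ ∘ G, he.measurable.comp hG, ⟨fun y => ?_⟩⟩
  rw [Measure.map_apply (he.measurable.comp hG) (measurableSet_singleton y), Set.preimage_comp]
  have hs : (embeddingReal (List Bool → Prop) ⁻¹' {y}).Subsingleton :=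
    fun a ha b hb => he.injective (ha.trans hb.symm)
  rcases hs.eq_empty_or_singleton with h | ⟨x, h⟩
  · simp [h]
  · rw [h]; exact hfib x

/-- A nonatomic finite measure is carried onto any measure of the same mass on a standard Borel
space by some measurable map. -/
theorem IsNonatomic.exists_measurable_map_eq {μ : Measure Ω} [IsFiniteMeasure μ]
    (hμ : IsNonatomic μ) {T : Type*} [MeasurableSpace T] [StandardBorelSpace T] [Nonempty T]
    (m : Measure T) (hm : m Set.univ = μ Set.univ) :
    ∃ f : Ω → T, Measurable f ∧ μ.map f = m := by
  by_cases h0 : μ Set.univ = 0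
  · refine ⟨fun _ => Classical.arbitrary T, measurable_const, ?_⟩
    rw [Measure.measure_univ_eq_zero.1 h0, Measure.map_zero,
      Measure.measure_univ_eq_zero.1 (hm.trans h0)]
  obtain ⟨g, hg, hna⟩ := exists_nullSingleton_map μ hμ
  set c := μ Set.univ
  have hc : c ≠ ⊤ := by finiteness
  let ν : Measure ℝ := c⁻¹ • μ.map g
  have hν : IsProbabilityMeasure ν := ⟨by
    simp only [ν, Measure.smul_apply, Measure.map_apply hg MeasurableSet.univ, Set.preimage_univ,
      smul_eq_mul]
    exact ENNReal.inv_mul_cancel h0 hc⟩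
  have hν' : NullSingletonClass ν := ⟨fun x => by simp [ν]⟩
  have hm' : IsProbabilityMeasure (c⁻¹ • m) := ⟨by
    rw [Measure.smul_apply, hm, smul_eq_mul]
    exact ENNReal.inv_mul_cancel h0 hc⟩
  obtain ⟨F, hF, hFν⟩ := exists_map_eq_volume_unitInterval ν
  obtain ⟨φ, hφ, hφm⟩ := Measure.exists_measurable_map_eq (c⁻¹ • m)
  refine ⟨φ ∘ F ∘ g, hφ.comp (hF.comp hg), ?_⟩
  have h : c⁻¹ • μ.map (φ ∘ F ∘ g) = c⁻¹ • m := by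
    rw [← hφm, ← hFν, ← Measure.map_map hφ (hF.comp hg), ← Measure.map_map hF hg,
      Measure.map_smul, Measure.map_smul]
  have h2 := congrArg (fun m => c • m) h
  simpa [smul_smul, ENNReal.mul_inv_cancel h0 hc] using h2

theorem IsNonatomic.restrict {μ : Measure Ω} (hμ : IsNonatomic μ) {E : Set Ω}
    (hE : MeasurableSet E) : IsNonatomic (μ.restrict E) := by
  intro A hA hpos
  rw [Measure.restrict_apply hA] at hpos
  obtain ⟨B, hB, hBm, h1, h2⟩ := hμ _ (hA.inter hE) hpos
  refine ⟨B, hB.trans Set.inter_subset_left, hBm, ?_⟩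
  rw [Measure.restrict_apply hBm, Measure.restrict_apply hA,
    Set.inter_eq_left.2 (hB.trans Set.inter_subset_right)]
  exact ⟨h1, h2⟩

end Nonatomic

/-! ### Finite transport via Hall's theorem -/

section Transport

open Finset

/-- Transport with integer masses: the deficiency form of Hall's theorem with multiplicities. -/
theorem exists_nat_transport {ι : Type*} [Fintype ι] [DecidableEq ι] (R : ι → ι → Prop)
    [DecidableRel R] (p r : ι → ℕ) (D : ℕ)
    (h : ∀ J : Finset ι, ∑ i ∈ J, p i ≤ ∑ j with ∃ i ∈ J, R i j, r j + D) :
    ∃ t : ι → ι → ℕ, (∀ i j, ¬ R i j → t i j = 0) ∧ (∀ i, ∑ j, t i j ≤ p i) ∧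
      (∀ j, ∑ i, t i j ≤ r j) ∧ ∑ i, p i ≤ ∑ i, ∑ j, t i j + D := by
  classical
  -- Each point is replaced by as many copies as its mass; `D` jokers, related to everything, absorb
  -- the deficiency.
  let α := Σ i, Fin (p i)
  let β := (Σ j, Fin (r j)) ⊕ Fin D
  let rel : α → β → Prop := fun a b => Sum.elim (fun b => R a.1 b.1) (fun _ => True) b
  obtain ⟨f, hf, hrel⟩ := (Fintype.all_card_le_filter_rel_iff_exists_injective rel).1 (by
    intro A
    rcases A.eq_empty_or_nonempty with rfl | ⟨a₀, ha₀⟩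
    · simp
    have h1 : #A ≤ ∑ i ∈ A.image Sigma.fst, p i := by
      calc #A ≤ #((A.image Sigma.fst).sigma fun i => (univ : Finset (Fin (p i)))) :=
            card_le_card fun a ha => mem_sigma.2 ⟨mem_image_of_mem _ ha, mem_univ _⟩
        _ = _ := by simp
    refine (h1.trans (h _)).trans ?_
    calc _ = #(((univ.filter fun j => ∃ i ∈ A.image Sigma.fst, R i j).sigma
            fun j => (univ : Finset (Fin (r j)))).disjSum (univ : Finset (Fin D))) := by simp
      _ ≤ _ := card_le_card fun b hb => by
        rcases b with b | b
        · simp only [inl_mem_disjSum, mem_sigma, mem_filter, mem_univ, true_and, and_true,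
            mem_image] at hb
          obtain ⟨_, ⟨a, ha, rfl⟩, hR⟩ := hb
          exact mem_filter.2 ⟨mem_univ _, a, ha, hR⟩
        · exact mem_filter.2 ⟨mem_univ _, a₀, ha₀, trivial⟩)
  let S : ι → ι → Finset α := fun i j => {a | a.1 = i ∧ ∃ b : Σ j, Fin (r j), f a = .inl b ∧ b.1 = j}
  have hS : ∀ i j a, a ∈ S i j ↔ a.1 = i ∧ ∃ b : Σ j, Fin (r j), f a = .inl b ∧ b.1 = j := by
    simp [S]
  refine ⟨fun i j => #(S i j), fun i j hR => ?_, fun i => ?_, fun j => ?_, ?_⟩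
  · rw [card_eq_zero, eq_empty_iff_forall_notMem]
    intro a ha
    obtain ⟨rfl, b, hb, rfl⟩ := (hS _ _ _).1 ha
    have := hrel a
    rw [hb] at this
    exact hR this
  · rw [← card_biUnion]
    · calc _ ≤ #(({i} : Finset ι).sigma fun i => (univ : Finset (Fin (p i)))) :=
            card_le_card fun a ha => by
              obtain ⟨j, -, ha⟩ := mem_biUnion.1 ha
              simp [((hS _ _ _).1 ha).1]
        _ = p i := by simp
    · intro j _ j' _ hjj
      refine disjoint_left.2 fun a ha ha' => hjj ?_
      obtain ⟨-, b, hb, rfl⟩ := (hS _ _ _).1 ha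
      obtain ⟨-, b', hb', rfl⟩ := (hS _ _ _).1 ha'
      rw [Sum.inl.inj (hb.symm.trans hb')]
  · rw [← card_biUnion]
    · calc _ ≤ #((({j} : Finset ι).sigma fun j => (univ : Finset (Fin (r j)))).map
              ⟨Sum.inl (β := Fin D), Sum.inl_injective⟩) :=
            card_le_card_of_injOn f (fun a ha => by
              obtain ⟨i, -, ha⟩ := mem_biUnion.1 (mem_coe.1 ha)
              obtain ⟨-, b, hb, rfl⟩ := (hS _ _ _).1 ha
              rw [hb]
              exact mem_coe.2 (mem_map_of_mem _ (by simp))) hf.injOn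
        _ = r j := by simp
    · intro j _ j' _ hjj
      refine disjoint_left.2 fun a ha ha' => hjj ?_
      exact ((hS _ _ _).1 ha).1.symm.trans ((hS _ _ _).1 ha').1
  · have h1 : ∑ i, p i = #(univ : Finset α) := by simp [α]
    have h2 : (univ : Finset α) ⊆ ((univ : Finset (ι × ι)).biUnion fun x => S x.1 x.2) ∪
        (univ.filter fun a => ∃ d : Fin D, f a = .inr d) := by
      intro a _
      rcases hfa : f a with b | d
      · exact mem_union_left _ (mem_biUnion.2 ⟨(a.1, b.1), mem_univ _, (hS _ _ _).2 ⟨rfl, b, hfa, rfl⟩⟩)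
      · exact mem_union_right _ (mem_filter.2 ⟨mem_univ _, d, hfa⟩)
    rw [h1]
    refine (card_le_card h2).trans ((card_union_le _ _).trans (add_le_add ?_ ?_))
    · refine card_biUnion_le.trans ?_
      rw [Fintype.sum_prod_type]
    · calc _ ≤ #((univ : Finset (Fin D)).map
              ⟨Sum.inr (α := Σ j, Fin (r j)), Sum.inr_injective⟩) :=
            card_le_card_of_injOn f (fun a ha => by
              obtain ⟨-, d, hd⟩ := mem_filter.1 (mem_coe.1 ha)
              rw [hd]
              exact mem_coe.2 (mem_map_of_mem _ (by simp))) hf.injOn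
        _ = D := by simp

/-- A matrix of nonnegative numbers with subprobability marginals can be completed to one with
prescribed marginals. -/
theorem exists_completion {ι : Type*} [Fintype ι] (p r : ι → ℝ) (hpr : ∑ i, p i = ∑ i, r i)
    (s : ι → ι → ℝ) (hsp : ∀ i, ∑ j, s i j ≤ p i)
    (hsr : ∀ j, ∑ i, s i j ≤ r j) :
    ∃ T : ι → ι → ℝ, (∀ i j, s i j ≤ T i j) ∧ (∀ i, ∑ j, T i j = p i) ∧
      (∀ j, ∑ i, T i j = r j) := by
  let a : ι → ℝ := fun i => p i - ∑ j, s i j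
  let b : ι → ℝ := fun j => r j - ∑ i, s i j
  have ha : ∀ i, 0 ≤ a i := fun i => sub_nonneg.2 (hsp i)
  have hb : ∀ i, 0 ≤ b i := fun i => sub_nonneg.2 (hsr i)
  have hab : ∑ i, a i = ∑ j, b j := by
    simp only [a, b, sum_sub_distrib, hpr]
    rw [sum_comm]
  have hL : 0 ≤ ∑ i, a i := sum_nonneg fun i _ => ha i
  -- The residual marginals are filled by their normalized product; if their total is 0, they vanish
  -- and division by zero is harmless.
  have key : ∀ c : ℝ, (∑ i, a i = 0 → c = 0) → c * (∑ i, a i) / (∑ i, a i) = c := by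
    intro c hc
    by_cases h : ∑ i, a i = 0
    · simp [hc h]
    · exact mul_div_cancel_right₀ _ h
  refine ⟨fun i j => s i j + a i * b j / ∑ i, a i, fun i j => ?_, fun i => ?_, fun j => ?_⟩
  · have := div_nonneg (mul_nonneg (ha i) (hb j)) hL
    linarith
  · rw [sum_add_distrib, ← sum_div, ← mul_sum, ← hab, key]
    · simp [a]
    · intro h
      exact (sum_eq_zero_iff_of_nonneg fun i _ => ha i).1 h i (mem_univ _)
  · rw [sum_add_distrib, ← sum_div, ← sum_mul, mul_comm, key]
    · simp [b]
    · intro h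
      rw [hab] at h
      exact (sum_eq_zero_iff_of_nonneg fun i _ => hb i).1 h j (mem_univ _)

/-- Strassen's theorem on a finite set, up to an arbitrarily small error. -/
theorem exists_finite_coupling {ι : Type*} [Fintype ι] [DecidableEq ι] (R : ι → ι → Prop)
    [DecidableRel R] (p r : ι → ℝ)
    (hp0 : ∀ i, 0 ≤ p i) (hr0 : ∀ i, 0 ≤ r i) (hp : ∑ i, p i = 1) (hr : ∑ i, r i = 1)
    {D η : ℝ} (hD : 0 ≤ D) (hη : 0 < η)
    (h : ∀ J : Finset ι, ∑ i ∈ J, p i ≤ ∑ j with ∃ i ∈ J, R i j, r j + D) :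
    ∃ T : ι → ι → ℝ, (∀ i j, 0 ≤ T i j) ∧ (∀ i, ∑ j, T i j = p i) ∧ (∀ j, ∑ i, T i j = r j) ∧
      ∑ i, ∑ j, (if R i j then 0 else T i j) ≤ D + η := by
  let n : ℕ := Fintype.card ι
  -- Masses are scaled by `M` and rounded: the floors of `r` and of `p` cost `n` each, the ceiling
  -- of `M * D` costs 1.
  obtain ⟨M, hM⟩ := exists_nat_gt ((2 * n + 1) / η)
  have hM0 : (0 : ℝ) < M := lt_of_le_of_lt (by positivity) hM
  have hfl : ∀ x : ℝ, 0 ≤ x → (⌊M * x⌋₊ : ℝ) ≤ M * x := fun x hx => Nat.floor_le (by positivity)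
  have hlf : ∀ x : ℝ, M * x ≤ (⌊M * x⌋₊ : ℝ) + 1 := fun x => (Nat.lt_floor_add_one _).le
  have hcard : ∀ (J : Finset ι) (x : ι → ℝ), M * ∑ i ∈ J, x i ≤ ∑ i ∈ J, (⌊M * x i⌋₊ : ℝ) + n := by
    intro J x
    calc M * ∑ i ∈ J, x i ≤ ∑ i ∈ J, ((⌊M * x i⌋₊ : ℝ) + 1) := by
          rw [mul_sum]; exact sum_le_sum fun i _ => hlf _
      _ = ∑ i ∈ J, (⌊M * x i⌋₊ : ℝ) + (#J : ℝ) := by simp [sum_add_distrib]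
      _ ≤ _ := by
        have : (#J : ℝ) ≤ n := by exact_mod_cast card_le_univ J
        linarith
  obtain ⟨t, htR, htp, htr, htot⟩ := exists_nat_transport R (fun i => ⌊M * p i⌋₊)
    (fun i => ⌊M * r i⌋₊) (n + ⌈M * D⌉₊) (by
      intro J
      have h1 : (∑ i ∈ J, (⌊M * p i⌋₊ : ℝ)) ≤ M * ∑ i ∈ J, p i := by
        rw [mul_sum]; exact sum_le_sum fun i _ => hfl _ (hp0 i)
      have h2 := mul_le_mul_of_nonneg_left (h J) hM0.le
      have h3 := hcard (univ.filter fun j => ∃ i ∈ J, R i j) r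
      have h4 := Nat.le_ceil (M * D)
      have : (∑ i ∈ J, (⌊M * p i⌋₊ : ℝ)) ≤
          ∑ j with ∃ i ∈ J, R i j, (⌊M * r j⌋₊ : ℝ) + (n + ⌈M * D⌉₊) := by linarith
      exact_mod_cast this)
  have hrow : ∀ i, ∑ j, (t i j : ℝ) / M ≤ p i := fun i => by
    rw [← sum_div, div_le_iff₀ hM0, mul_comm]
    refine le_trans ?_ (hfl _ (hp0 i))
    exact_mod_cast htp i
  have hcol : ∀ j, ∑ i, (t i j : ℝ) / M ≤ r j := fun j => by
    rw [← sum_div, div_le_iff₀ hM0, mul_comm]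
    refine le_trans ?_ (hfl _ (hr0 j))
    exact_mod_cast htr j
  obtain ⟨T, hT, hTp, hTr⟩ := exists_completion p r (hp.trans hr.symm) (fun i j => (t i j : ℝ) / M)
    hrow hcol
  have hT0 : ∀ i j, 0 ≤ T i j := fun i j => le_trans (by positivity) (hT i j)
  refine ⟨T, hT0, hTp, hTr, ?_⟩
  have h1 : ∑ i, ∑ j, (if R i j then 0 else T i j) ≤ ∑ i, ∑ j, (T i j - (t i j : ℝ) / M) := by
    refine sum_le_sum fun i _ => sum_le_sum fun j _ => ?_
    split_ifs with hR
    · exact sub_nonneg.2 (hT i j)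
    · simp [htR i j hR]
  have h2 : ∑ i, ∑ j, (T i j - (t i j : ℝ) / M) = 1 - (∑ i, ∑ j, (t i j : ℝ)) / M := by
    simp only [sum_sub_distrib, hTp, hp, sum_div]
  have h3 : (∑ i, (⌊M * p i⌋₊ : ℝ)) ≤ ∑ i, ∑ j, (t i j : ℝ) + (n + ⌈M * D⌉₊) := by
    exact_mod_cast htot
  have h4 := hcard univ p
  rw [hp] at h4
  have h5 := (Nat.ceil_lt_add_one (a := M * D) (by positivity)).le
  rw [div_lt_iff₀ hη] at hM
  have h6 : 1 - (D + η) ≤ (∑ i, ∑ j, (t i j : ℝ)) / M := by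
    rw [le_div_iff₀ hM0]
    linarith
  linarith

end Transport

/-! ### Gluing rearrangements over cells -/

section Rearrangement

variable {Ω S ι : Type*} [MeasurableSpace Ω] [Fintype ι] [MeasurableSpace ι]
  [MeasurableSingletonClass ι]

/-- On a nonatomic space, a random variable can be rearranged so that its discretization has a
prescribed joint law with the discretization of another one. -/
theorem exists_rearrangement {P : Measure Ω} [IsProbabilityMeasure P] (hP : IsNonatomic P)
    [MeasurableSpace S] [StandardBorelSpace S] [Nonempty S] {X : Ω → S} (hX : Measurable X)
    (ν : Measure S) [IsFiniteMeasure ν] {k : S → ι} (hk : Measurable k) (T : ι → ι → ℝ)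
    (hT : ∀ i j, 0 ≤ T i j)
    (hrow : ∀ i, ∑ j, T i j = (P.map X).real (k ⁻¹' {i}))
    (hcol : ∀ j, ∑ i, T i j = ν.real (k ⁻¹' {j})) :
    ∃ Y' : Ω → S, Measurable Y' ∧ P.map Y' = ν ∧
      ∀ i j, P.real {ω | k (X ω) = i ∧ k (Y' ω) = j} = T i j := by
  classical
  have hA : ∀ j, MeasurableSet (k ⁻¹' {j}) := fun j => hk (measurableSet_singleton j)
  let r : ι → ℝ := fun j => ν.real (k ⁻¹' {j})
  have hr : ∀ j, ν (k ⁻¹' {j}) = ENNReal.ofReal (r j) := fun j => by simp [r]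
  have hTr : ∀ i j, r j = 0 → T i j = 0 := fun i j h =>
    (Finset.sum_eq_zero_iff_of_nonneg fun i _ => hT i j).1 ((hcol j).trans h) i (Finset.mem_univ _)
  have hr0 : ∀ j, 0 ≤ r j := fun j => measureReal_nonneg
  have hTdiv : ∀ i j, 0 ≤ T i j / r j := fun i j => div_nonneg (hT i j) (hr0 j)
  have hmass : ∀ i j, ENNReal.ofReal (T i j / r j) * ν (k ⁻¹' {j}) = ENNReal.ofReal (T i j) := by
    intro i j
    rw [hr, ← ENNReal.ofReal_mul (hTdiv i j), div_mul_cancel_of_imp (hTr i j)]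
  -- `m i` gives cell `j` mass `T i j`, spread there in proportion to `ν`; the column sums make the
  -- `m i` add up to `ν`.
  let m : ι → Measure S := fun i => ∑ j, ENNReal.ofReal (T i j / r j) • ν.restrict (k ⁻¹' {j})
  have hm : ∀ i E, m i E = ∑ j, ENNReal.ofReal (T i j / r j) * ν.restrict (k ⁻¹' {j}) E := by
    intro i E
    simp [m]
  have hmA : ∀ i j, m i (k ⁻¹' {j}) = ENNReal.ofReal (T i j) := by
    intro i j
    rw [hm, Finset.sum_eq_single j, Measure.restrict_apply_self, hmass]
    · intro j' _ hj
      rw [Measure.restrict_apply (hA j), ← Set.preimage_inter,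
        Set.singleton_inter_eq_empty.2 (by simpa using hj.symm)]
      simp
    · simp
  have hsum : ∑ i, m i = ν := by
    calc ∑ i, m i = ∑ j, (∑ i, ENNReal.ofReal (T i j / r j)) • ν.restrict (k ⁻¹' {j}) := by
          simp only [m, Finset.sum_smul]
          exact Finset.sum_comm
      _ = ∑ j, ν.restrict (k ⁻¹' {j}) := by
          refine Finset.sum_congr rfl fun j _ => ?_
          by_cases h : r j = 0
          · have : ν.restrict (k ⁻¹' {j}) = 0 := by
              rw [Measure.restrict_eq_zero, hr, h, ENNReal.ofReal_zero]
            simp [this]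
          · rw [← ENNReal.ofReal_sum_of_nonneg fun i _ => hTdiv i j, ← Finset.sum_div, hcol j,
              div_self h, ENNReal.ofReal_one, one_smul]
      _ = ν := by
          ext E hE
          simp only [Measure.coe_finsetSum, Finset.sum_apply, Measure.restrict_apply hE]
          have := sum_measure_preimage_singleton (μ := ν.restrict E) Finset.univ
            (f := k) fun j _ => hA j
          simpa [Measure.restrict_apply (hA _), Set.inter_comm] using this
  have hB : ∀ i, MeasurableSet (X ⁻¹' (k ⁻¹' {i})) := fun i => hX (hA i)
  have hex : ∀ i, ∃ f : Ω → S, Measurable f ∧ (P.restrict (X ⁻¹' (k ⁻¹' {i}))).map f = m i := by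
    intro i
    refine (hP.restrict (hB i)).exists_measurable_map_eq (m i) ?_
    rw [Measure.restrict_apply_univ, hm]
    simp only [Measure.restrict_apply_univ, hmass]
    rw [← ENNReal.ofReal_sum_of_nonneg fun j _ => hT i j, hrow, ofReal_measureReal,
      Measure.map_apply hX (hA i)]
  choose f hf hfm using hex
  have hY : Measurable fun ω => f (k (X ω)) ω :=
    (measurable_from_prod_countable_right (f := fun q : ι × Ω => f q.1 q.2) hf).comp
      ((hk.comp hX).prodMk measurable_id)
  have hpiece : ∀ i E, MeasurableSet E →
      P ((fun ω => f (k (X ω)) ω) ⁻¹' E ∩ X ⁻¹' (k ⁻¹' {i})) = m i E := by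
    intro i E hE
    rw [← hfm, Measure.map_apply (hf i) hE, Measure.restrict_apply (hf i hE)]
    congr 1
    ext ω
    simp only [Set.mem_inter_iff, Set.mem_preimage, Set.mem_singleton_iff]
    constructor <;> (rintro ⟨h1, h2⟩; subst h2; exact ⟨h1, rfl⟩)
  refine ⟨fun ω => f (k (X ω)) ω, hY, ?_, fun i j => ?_⟩
  · rw [← hsum]
    ext E hE
    rw [Measure.map_apply hY hE]
    simp only [Measure.coe_finsetSum, Finset.sum_apply, ← hpiece _ E hE]
    have := sum_measure_preimage_singleton (μ := P.restrict ((fun ω => f (k (X ω)) ω) ⁻¹' E))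
      Finset.univ (f := k ∘ X) fun j _ => hB j
    simp only [Set.preimage_comp, Measure.restrict_apply (hB _), Finset.coe_univ,
      Set.preimage_univ, Measure.restrict_apply MeasurableSet.univ, Set.univ_inter] at this
    rw [← this]
    exact Finset.sum_congr rfl fun i _ => by rw [Set.inter_comm]
  · have h := hpiece i _ (hA j)
    rw [hmA] at h
    rw [measureReal_def, ← ENNReal.toReal_ofReal (hT i j), ← h]
    congr 2
    ext ω
    exact and_comm

end Rearrangement

/-! ### Discretization and the main theorem -/

/-- A separable metric space splits into finitely many measurable cells, all of which are small
except for one, which has small mass for two given finite measures. -/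
theorem exists_finite_discretization {S : Type*} [MetricSpace S]
    [TopologicalSpace.SeparableSpace S] [MeasurableSpace S] [BorelSpace S]
    (μ ν : Measure S) [IsFiniteMeasure μ] [IsFiniteMeasure ν] {η : ℝ} (hη : 0 < η) :
    ∃ (N : ℕ) (k : S → Fin (N + 1)), Measurable k ∧
      (∀ x y, k x = k y → k x ≠ Fin.last N → dist x y ≤ η) ∧
      μ.real (k ⁻¹' {Fin.last N}) ≤ η ∧ ν.real (k ⁻¹' {Fin.last N}) ≤ η := by
  obtain ⟨A, hAm, hAb, hAd, hAU, hAdisj⟩ :=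
    SeparableSpace.exists_measurable_partition_diam_le S hη
  choose c hc using fun x : S => Set.mem_iUnion.1 (hAU ▸ Set.mem_univ x : x ∈ ⋃ n, A n)
  have hcA : ∀ n, c ⁻¹' {n} = A n := by
    intro n
    ext x
    refine ⟨fun h => h ▸ hc x, fun h => ?_⟩
    by_contra hne
    exact Set.disjoint_left.1 (hAdisj hne) (hc x) h
  have hcm : Measurable c := measurable_to_countable' fun n => hcA n ▸ hAm n
  have hlim : ∀ (ρ : Measure S) [IsFiniteMeasure ρ],
      ∀ᶠ N in Filter.atTop, ρ (c ⁻¹' Set.Ici N) < ENNReal.ofReal η := by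
    intro ρ _
    have h := tendsto_measure_iInter_atTop (μ := ρ) (s := fun N : ℕ => c ⁻¹' Set.Ici N)
      (fun N => (hcm measurableSet_Ici).nullMeasurableSet)
      (fun a b hab => Set.preimage_mono (Set.Ici_subset_Ici.2 hab)) ⟨0, by finiteness⟩
    have h0 : ⋂ N : ℕ, c ⁻¹' Set.Ici N = ∅ := by
      ext x
      simp only [Set.mem_iInter, Set.mem_preimage, Set.mem_Ici, Set.mem_empty_iff_false, iff_false]
      intro h
      exact absurd (h (c x + 1)) (by omega)
    rw [h0, measure_empty] at h
    exact h.eventually (gt_mem_nhds (ENNReal.ofReal_pos.2 hη))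
  obtain ⟨N, hμ, hν⟩ := ((hlim μ).and (hlim ν)).exists
  -- All cells from index `N` on merge into the last one.
  let φ : ℕ → Fin (N + 1) := fun n => ⟨min n N, by omega⟩
  have hlast : (φ ∘ c) ⁻¹' {Fin.last N} = c ⁻¹' Set.Ici N := by
    ext x
    simp [φ, Fin.ext_iff]
  refine ⟨N, φ ∘ c, (measurable_from_nat (f := φ)).comp hcm, fun x y hxy hx => ?_, ?_, ?_⟩
  · have h1 : c x = c y := by
      simp only [φ, Function.comp, Fin.ext_iff, Fin.val_last, ne_eq] at hxy hx
      omega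
    exact (Metric.dist_le_diam_of_mem (hAb _) (hc x) (h1 ▸ hc y)).trans (hAd _)
  · rw [hlast, measureReal_def]
    exact ENNReal.toReal_le_of_le_ofReal hη.le hμ.le
  · rw [hlast, measureReal_def]
    exact ENNReal.toReal_le_of_le_ofReal hη.le hν.le

theorem mainTheorem4 {Ω S : Type*} [MeasurableSpace Ω] (P : Measure Ω) [IsProbabilityMeasure P]
    [P.IsComplete] (hP : IsNonatomic P)
    [MetricSpace S] [CompleteSpace S] [TopologicalSpace.SeparableSpace S]
    [MeasurableSpace S] [BorelSpace S]
    (X Y : Ω → S) (hX : Measurable X) (hY : Measurable Y)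
    (ε : ℝ) (hε : 0 < ε) (hq : prokhorovDist (P.map X) (P.map Y) < ε) :
    ∃ Y' : Ω → S, Measurable Y' ∧ P.map Y' = P.map Y ∧ kyFanDist P X Y' < ε := by
  have hne : Nonempty Ω := nonempty_of_isProbabilityMeasure P
  have : Nonempty S := hne.map X
  have hμ : IsProbabilityMeasure (P.map X) := Measure.isProbabilityMeasure_map hX.aemeasurable
  have hν : IsProbabilityMeasure (P.map Y) := Measure.isProbabilityMeasure_map hY.aemeasurable
  set μ := P.map X
  set ν := P.map Y
  -- The value 1 is always admissible, so the infimum is not the default `sInf ∅ = 0`.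
  obtain ⟨δ, ⟨hδ0, hδ⟩, hδε⟩ := exists_lt_of_csInf_lt
    (⟨1, one_pos, fun A _ => by
      rw [ENNReal.ofReal_one]
      exact prob_le_one.trans le_add_self⟩ : Set.Nonempty {ε : ℝ | 0 < ε ∧ ∀ A : Set S,
        IsClosed A → μ A ≤ ν (Metric.thickening ε A) + ENNReal.ofReal ε}) hq
  -- In probability, `3 * η` pays for the last cell under `μ`, the last cell under `ν`, and
  -- rounding; in distance, two cell diameters need only `2 * η`.
  obtain ⟨η, hη, hηε⟩ : ∃ η > 0, δ + 3 * η < ε := ⟨(ε - δ) / 4, by linarith, by linarith⟩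
  obtain ⟨N, k, hk, hsmall, hμN, hνN⟩ := exists_finite_discretization μ ν hη
  have hA : ∀ j, MeasurableSet (k ⁻¹' {j}) := fun j => hk (measurableSet_singleton j)
  have hsumreal : ∀ (ρ : Measure S) [IsFiniteMeasure ρ] (J : Finset (Fin (N + 1))),
      ∑ i ∈ J, ρ.real (k ⁻¹' {i}) = ρ.real (k ⁻¹' J) := fun ρ _ J =>
    sum_measureReal_preimage_singleton J fun j _ => hA j
  let R : Fin (N + 1) → Fin (N + 1) → Prop := fun i j =>
    i ≠ Fin.last N ∧ j ≠ Fin.last N ∧ ∃ a b, k a = i ∧ k b = j ∧ dist a b < δ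
  have : DecidableRel R := Classical.decRel R
  obtain ⟨T, hT0, hTp, hTr, hTR⟩ := exists_finite_coupling R (fun i => μ.real (k ⁻¹' {i}))
    (fun i => ν.real (k ⁻¹' {i})) (fun _ => measureReal_nonneg) (fun _ => measureReal_nonneg)
    (by simp [hsumreal]) (by simp [hsumreal]) (D := δ + 2 * η) (by linarith) hη (by
      intro J
      rw [hsumreal, hsumreal, Finset.coe_filter_univ]
      set E : Set S := k ⁻¹' (J.erase (Fin.last N) : Finset _)
      set F : Set S := {y | ∃ i ∈ J, R i (k y)}
      have h1 : μ.real (k ⁻¹' J) ≤ μ.real E + η := by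
        refine (measureReal_mono (s₂ := E ∪ k ⁻¹' {Fin.last N}) fun x hx => ?_).trans
          ((measureReal_union_le _ _).trans (by linarith))
        by_cases h : k x = Fin.last N
        · exact Or.inr h
        · exact Or.inl (Finset.mem_coe.2 (Finset.mem_erase.2 ⟨h, hx⟩))
      have h2 : μ.real E ≤ ν.real (Metric.thickening δ E) + δ := by
        -- `E` need not be closed, but it has the same thickening as its closure.
        have h := (measure_mono subset_closure).trans (hδ (closure E) isClosed_closure)
        rw [Metric.thickening_closure] at h
        have := ENNReal.toReal_mono (by finiteness) h
        rwa [ENNReal.toReal_add (by finiteness) (by finiteness),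
          ENNReal.toReal_ofReal hδ0.le] at this
      have h3 : ν.real (Metric.thickening δ E) ≤ ν.real F + η := by
        refine (measureReal_mono (s₂ := F ∪ k ⁻¹' {Fin.last N}) fun y hy => ?_).trans
          ((measureReal_union_le _ _).trans (by linarith))
        by_cases h : k y = Fin.last N
        · exact Or.inr h
        · obtain ⟨x, hx, hxy⟩ := Metric.mem_thickening_iff.1 hy
          obtain ⟨hx1, hx2⟩ := Finset.mem_erase.1 (Finset.mem_coe.1 hx)
          have hR : R (k x) (k y) := ⟨hx1, h, x, y, rfl, rfl, by rwa [dist_comm]⟩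
          exact Or.inl ⟨k x, hx2, hR⟩
      change μ.real _ ≤ ν.real F + _
      linarith)
  obtain ⟨Y', hY', hlaw, hjoint⟩ := exists_rearrangement hP hX ν hk T hT0 hTp hTr
  refine ⟨Y', hY', hlaw, lt_of_le_of_lt (csInf_le ⟨0, fun x hx => hx.1.le⟩ ⟨?_, ?_⟩) hηε⟩
  · positivity
  have hsub : {ω | δ + 3 * η ≤ dist (X ω) (Y' ω)} ⊆
      ⋃ q ∈ (Finset.univ.filter fun q : Fin (N + 1) × Fin (N + 1) => ¬ R q.1 q.2),
        {ω | k (X ω) = q.1 ∧ k (Y' ω) = q.2} := by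
    intro ω hω
    refine Set.mem_biUnion (x := (k (X ω), k (Y' ω))) ?_ ⟨rfl, rfl⟩
    refine Finset.mem_coe.2 (Finset.mem_filter.2 ⟨Finset.mem_univ _, ?_⟩)
    rintro ⟨hi, hj, a, b, ha, hb, hab⟩
    have h1 := hsmall (X ω) a ha.symm hi
    have h2 := hsmall (Y' ω) b hb.symm hj
    have h3 := dist_triangle4 (X ω) a b (Y' ω)
    rw [dist_comm] at h2
    have h4 : δ + 3 * η ≤ dist (X ω) (Y' ω) := hω
    linarith
  have hbound : P.real {ω | δ + 3 * η ≤ dist (X ω) (Y' ω)} ≤ δ + 3 * η := by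
    calc _ ≤ _ := measureReal_mono hsub (by exact measure_ne_top _ _)
      _ ≤ _ := measureReal_biUnion_finset_le _ _
      _ = ∑ i, ∑ j, (if R i j then 0 else T i j) := by
        simp only [hjoint, Finset.sum_filter, Fintype.sum_prod_type, ite_not]
      _ ≤ _ := by linarith
  rw [← ofReal_measureReal]
  exact ENNReal.ofReal_le_ofReal hbound
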